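/- Call a function $f : \mathbb{Z}[i] \to \mathbb{Z}_{\ge 0}$ a Euclidean function if for all $a, b \in \mathbb{Z}[i]$ with $b \neq 0$ there exist $q, r \in \mathbb{Z}[i]$ such that $a = qb + r$ and either $r = 0$ or $f(r) < f(b)$ (no condition is imposed on $f(0)$). Let $\phi_{\mathbb{Z}[i]}$ be the minimal Euclidean function on the Gaussian integers, that is, $$\phi_{\mathbb{Z}[i]}(x) = \min\{ f(x) : f \text{ is a Euclidean function on } \mathbb{Z}[i] \} \qquad (x \in \mathbb{Z}[i]);$$ in particular $\phi_{\mathbb{Z}[i]}(0) = 0$. **Theorem.** For every integer $k \geq 1$, the set $\phi_{\mathbb{Z}[i]}^{-1}([0,2k]) = \{x \in \mathbb{Z}[i] : \phi_{\mathbb{Z}[i]}(x) \le 2k\}$ is finite and $$\left|\phi_{\mathbb{Z}[i]}^{-1}([0,2k])\right| = 25 + 8k - 48\cdot 2^k + 28\cdot 4^k.$$ -/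

import Mathlib

/-- A Euclidean function on a commutative ring `R`: every `a` can be divided by every nonzero `b`,
with a remainder that is zero or has a strictly smaller value than `b`.
The value at `0` is unconstrained. -/
def IsEuclideanFunction (R : Type*) [CommRing R] (f : R → ℕ) : Prop :=
  ∀ a b : R, b ≠ 0 → ∃ q r : R, a = q * b + r ∧ (r = 0 ∨ f r < f b)

/-- The minimal Euclidean function of `R`: the pointwise minimum over all Euclidean functions
on `R`. (As values at `0` are unconstrained, it vanishes at `0`.) -/
noncomputable def minimalEuclideanFunction (R : Type*) [CommRing R] (x : R) : ℕ :=
  sInf {n : ℕ | ∃ f : R → ℕ, IsEuclideanFunction R f ∧ f x = n}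

/-- If `R` has some Euclidean function, then `minimalEuclideanFunction R` is itself a Euclidean
function, and the least one for the pointwise order. -/
theorem isLeast_minimalEuclideanFunction (R : Type*) [CommRing R] (g : R → ℕ)
    (hg : IsEuclideanFunction R g) :
    IsLeast {f : R → ℕ | IsEuclideanFunction R f} (minimalEuclideanFunction R) := by
  have hle : ∀ f : R → ℕ, IsEuclideanFunction R f → ∀ x, minimalEuclideanFunction R x ≤ f x :=
    fun f hf x => Nat.sInf_le ⟨f, hf, rfl⟩
  refine ⟨?_, fun f hf x => hle f hf x⟩
  intro a b hb
  obtain ⟨f, hf, hfb⟩ : ∃ f : R → ℕ, IsEuclideanFunction R f ∧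
      f b = minimalEuclideanFunction R b :=
    Nat.sInf_mem (s := {n : ℕ | ∃ f : R → ℕ, IsEuclideanFunction R f ∧ f b = n}) ⟨g b, g, hg, rfl⟩
  obtain ⟨q, r, h, hr⟩ := hf a b hb
  exact ⟨q, r, h, hr.imp id fun hlt => lt_of_le_of_lt (hle f hf r) (hfb ▸ hlt)⟩

/-- The absolute norm is a Euclidean function on the Gaussian integers. -/
theorem isEuclideanFunction_norm_gaussianInt :
    IsEuclideanFunction GaussianInt (fun x => x.norm.natAbs) := fun a b hb =>
  ⟨a / b, a % b, by rw [mul_comm]; exact (EuclideanDomain.div_add_mod a b).symm,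
    Or.inr (GaussianInt.natAbs_norm_mod_lt a hb)⟩

/-!
Motzkin's construction describes the sublevel sets of the minimal Euclidean function `φ`
recursively: a nonzero `x` satisfies `φ x ≤ n` if and only if every residue class modulo `x` meets
`{φ < n}`. For `ℤ[i]` these sets were made explicit by Lenstra and Graves: up to powers of `1 + i`,
they consist of the odd points (those not divisible by `1 + i`) of octagons that grow by a factor
of about `√2` from one level to the next.

The octagons are convex and invariant under multiplication by `i`. Hence they contain every divisor
of each of their nonzero points, and they meet all residue classes modulo `(1 + i) w` for each of
their nonzero points `w`. The first property shows that Motzkin's sets are not larger than claimed: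
if every class modulo `x` meets the set of level `n`, then `x` divides some nonzero
`(1 + i) ^ n - r` with `r` in that set, and these differences belong to level `n + 1`. The second
property shows that they are not smaller, except for the class of an odd `y` modulo an odd `x`
when both lie in the octagon of level `n + 1` but not in that of level `n`. In that case `y` is
reduced either modulo `(1 + i) x`, which keeps it odd, into the octagon of level `n`, or modulo `x`
into a star-shaped region all of whose points, odd or even, belong to level `n`.
-/

section Motzkin

variable {R : Type*} [CommRing R]

/-- The finite stages of Motzkin's construction. The indexing is shifted by one, so that stage
`n + 1` is the sublevel set `{φ ≤ n}` of the minimal Euclidean function `φ`. -/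
def motzkinSet (R : Type*) [CommRing R] : ℕ → Set R
  | 0 => {0}
  | n + 1 => {x | x = 0 ∨ ∀ a, ∃ r ∈ motzkinSet R n, x ∣ a - r}

theorem zero_mem_motzkinSet (n : ℕ) : (0 : R) ∈ motzkinSet R n := by
  cases n
  · rfl
  · exact Or.inl rfl

theorem IsEuclideanFunction.mem_motzkinSet {f : R → ℕ} (hf : IsEuclideanFunction R f) {n : ℕ}
    {x : R} (hx : f x < n) : x ∈ motzkinSet R n := by
  induction n generalizing x with
  | zero => exact absurd hx (Nat.not_lt_zero _)
  | succ n ih =>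
    refine or_iff_not_imp_left.mpr fun hx0 a => ?_
    obtain ⟨q, r, rfl, hr⟩ := hf a x hx0
    have hdvd : x ∣ q * x + r - r := by simp
    rcases hr with rfl | hr
    · exact ⟨0, zero_mem_motzkinSet n, hdvd⟩
    · exact ⟨r, ih (by lia), hdvd⟩

theorem isEuclideanFunction_sInf_motzkinSet (h : ∀ x : R, ∃ n, x ∈ motzkinSet R (n + 1)) :
    IsEuclideanFunction R fun x => sInf {n | x ∈ motzkinSet R (n + 1)} := by
  intro a b hb
  have hmem : b ∈ motzkinSet R (sInf {n | b ∈ motzkinSet R (n + 1)} + 1) := Nat.sInf_mem (h b)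
  obtain ⟨r, hr, q, hq⟩ := hmem.resolve_left hb a
  refine ⟨q, r, by linear_combination hq, ?_⟩
  cases hn : sInf {n | b ∈ motzkinSet R (n + 1)} with
  | zero => exact Or.inl (by rwa [hn] at hr)
  | succ m =>
    rw [hn] at hr
    exact Or.inr ((Nat.lt_succ_of_le (Nat.sInf_le hr)).trans_eq hn.symm)

theorem minimalEuclideanFunction_le_iff_mem_motzkinSet {g : R → ℕ}
    (hg : IsEuclideanFunction R g) {x : R} {n : ℕ} :
    minimalEuclideanFunction R x ≤ n ↔ x ∈ motzkinSet R (n + 1) := by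
  have hmin := isLeast_minimalEuclideanFunction R g hg
  refine ⟨fun h => hmin.1.mem_motzkinSet (Nat.lt_succ_of_le h), fun h => ?_⟩
  have hsInf := isEuclideanFunction_sInf_motzkinSet fun y : R =>
    ⟨g y, hg.mem_motzkinSet (Nat.lt_succ_self (g y))⟩
  exact (hmin.2 hsInf x).trans (Nat.sInf_le h)

end Motzkin

/-- The Gaussian prime `1 + i`. -/
def onePlusI : GaussianInt := ⟨1, 1⟩

theorem re_onePlusI_mul (z : GaussianInt) : (onePlusI * z).re = z.re - z.im := by
  simp [onePlusI, sub_eq_add_neg]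

theorem im_onePlusI_mul (z : GaussianInt) : (onePlusI * z).im = z.re + z.im := by
  simp [onePlusI, add_comm]

theorem onePlusI_dvd_iff {z : GaussianInt} : onePlusI ∣ z ↔ Even (z.re + z.im) := by
  constructor
  · rintro ⟨w, rfl⟩
    exact ⟨w.re, by rw [re_onePlusI_mul, im_onePlusI_mul]; ring⟩
  · rintro ⟨k, hk⟩
    exact ⟨⟨k, k - z.re⟩, by ext <;> simp only [re_onePlusI_mul, im_onePlusI_mul] <;> lia⟩

theorem onePlusI_dvd_star_iff {z : GaussianInt} : onePlusI ∣ star z ↔ onePlusI ∣ z := by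
  simp only [onePlusI_dvd_iff, Zsqrtd.re_star, Zsqrtd.im_star, Int.even_add, even_neg]

theorem prime_onePlusI : Prime onePlusI := by
  refine ⟨by decide, ?_, fun x y => ?_⟩
  · simp [isUnit_iff_dvd_one, onePlusI_dvd_iff]
  · simp only [onePlusI_dvd_iff, Zsqrtd.re_mul, Zsqrtd.im_mul, neg_mul, one_mul, Int.even_add,
      Int.even_mul, even_neg]
    tauto

/-- The lattice points of the octagon `max |re| |im| ≤ m`, `|re| + |im| ≤ s`. -/
def octagon (m s : ℤ) : Set GaussianInt := {z | |z.re| ≤ m ∧ |z.im| ≤ m ∧ |z.re| + |z.im| ≤ s}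

section Octagon

variable {m s m' s' : ℤ} {w x z : GaussianInt}

theorem mem_octagon : z ∈ octagon m s ↔ |z.re| ≤ m ∧ |z.im| ≤ m ∧ |z.re| + |z.im| ≤ s := Iff.rfl

theorem octagon_subset_octagon (hm : m ≤ m') (hs : s ≤ s') : octagon m s ⊆ octagon m' s' :=
  fun _ hz => ⟨hz.1.trans hm, hz.2.1.trans hm, hz.2.2.trans hs⟩

theorem sub_mem_octagon (hx : x ∈ octagon m s) (hz : z ∈ octagon m' s') :
    x - z ∈ octagon (m + m') (s + s') := by
  have hre := abs_sub x.re z.re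
  have him := abs_sub x.im z.im
  simp only [mem_octagon, Zsqrtd.re_sub, Zsqrtd.im_sub] at *
  lia

theorem onePlusI_mul_mem_octagon (hz : z ∈ octagon m s) : onePlusI * z ∈ octagon s (2 * m) := by
  simp only [mem_octagon, re_onePlusI_mul, im_onePlusI_mul, abs_eq_max_neg] at *
  omega

theorem mem_octagon_of_intCast_mul_eq {N : ℤ} (hN : 0 < N) {r t : GaussianInt}
    (ht : |t.re| + |t.im| ≤ N) (h : (N : GaussianInt) * r = t * w) (hw : w ∈ octagon m s) :
    r ∈ octagon m s := by
  obtain ⟨hre, him, hsum⟩ := hw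
  have hm : 0 ≤ m := (abs_nonneg _).trans hre
  have hs : 0 ≤ s := (add_nonneg (abs_nonneg _) (abs_nonneg _)).trans hsum
  have hr_re : N * |r.re| ≤ |t.re| * |w.re| + |t.im| * |w.im| := by
    have hre_eq : N * r.re = t.re * w.re - t.im * w.im := by
      simpa [sub_eq_add_neg] using congrArg Zsqrtd.re h
    simpa only [← hre_eq, abs_mul, abs_of_pos hN] using abs_sub (t.re * w.re) (t.im * w.im)
  have hr_im : N * |r.im| ≤ |t.re| * |w.im| + |t.im| * |w.re| := by
    have him_eq : N * r.im = t.re * w.im + t.im * w.re := by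
      simpa using congrArg Zsqrtd.im h
    simpa only [← him_eq, abs_mul, abs_of_pos hN] using abs_add_le (t.re * w.im) (t.im * w.re)
  refine ⟨?_, ?_, ?_⟩ <;> refine le_of_mul_le_mul_left ?_ hN
  · calc
      N * |r.re| ≤ |t.re| * m + |t.im| * m := hr_re.trans (by gcongr)
      _ ≤ N * m := by rw [← add_mul]; gcongr
  · calc
      N * |r.im| ≤ |t.re| * m + |t.im| * m := hr_im.trans (by gcongr)
      _ ≤ N * m := by rw [← add_mul]; gcongr
  · calc
      N * (|r.re| + |r.im|) ≤ |t.re| * (|w.re| + |w.im|) + |t.im| * (|w.re| + |w.im|) := by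
        linear_combination hr_re + hr_im
      _ ≤ |t.re| * s + |t.im| * s := by gcongr
      _ ≤ N * s := by rw [← add_mul]; gcongr

theorem mem_octagon_of_mul_mem_octagon (hz : z ≠ 0) (h : x * z ∈ octagon m s) :
    x ∈ octagon m s := by
  refine mem_octagon_of_intCast_mul_eq (N := z.norm) (t := star z) (GaussianInt.norm_pos.mpr hz)
    ?_ ?_ h
  · have hre := Int.natAbs_le_self_sq z.re
    have him := Int.natAbs_le_self_sq z.im
    rw [Int.natCast_natAbs] at hre him
    rw [Zsqrtd.norm_def, Zsqrtd.re_star, Zsqrtd.im_star, abs_neg]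
    linarith
  · rw [Zsqrtd.norm_eq_mul_conj]
    ring

theorem exists_abs_sub_mul_le {N : ℤ} (hN : 0 < N) (a : ℤ) : ∃ k, |a - 2 * N * k| ≤ N := by
  refine ⟨(a + N) / (2 * N), ?_⟩
  have hmod := Int.emod_add_mul_ediv (a + N) (2 * N)
  have hnonneg := Int.emod_nonneg (a + N) (by lia : 2 * N ≠ 0)
  have hlt := Int.emod_lt_of_pos (a + N) (by lia : 0 < 2 * N)
  rw [abs_le]
  lia

/- The remainder lies in the square with vertices `±w`, `±i w`, which is contained in the octagon
and is a fundamental domain for the lattice of multiples of `(1 + i) w`. -/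
theorem exists_mem_octagon_onePlusI_mul_dvd_sub (hw : w ≠ 0) (hmem : w ∈ octagon m s)
    (a : GaussianInt) : ∃ r ∈ octagon m s, onePlusI * w ∣ a - r := by
  have hN : 0 < w.norm := GaussianInt.norm_pos.mpr hw
  let b := a * star (onePlusI * w)
  obtain ⟨k, hk⟩ := exists_abs_sub_mul_le hN b.re
  obtain ⟨l, hl⟩ := exists_abs_sub_mul_le hN b.im
  let r := a - onePlusI * w * ⟨k, l⟩
  let t := r * star w
  have ht : star onePlusI * t = b - (2 * w.norm : ℤ) * ⟨k, l⟩ := by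
    have hnorm : (w.norm : GaussianInt) = w * star w := Zsqrtd.norm_eq_mul_conj w
    have htwo : star onePlusI * onePlusI = 2 := by decide
    push_cast
    simp only [t, r, b, star_mul, hnorm]
    linear_combination (-w * star w * ⟨k, l⟩) * htwo
  refine ⟨r, mem_octagon_of_intCast_mul_eq hN (t := t) ?_ ?_ hmem, ⟨⟨k, l⟩, sub_sub_self _ _⟩⟩
  · have hre : t.re + t.im = b.re - 2 * w.norm * k := by
      simpa [onePlusI] using congrArg Zsqrtd.re ht
    have him : t.im - t.re = b.im - 2 * w.norm * l := by
      simpa [onePlusI, sub_eq_add_neg] using congrArg Zsqrtd.im ht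
    rw [← hre] at hk
    rw [← him] at hl
    simp only [abs_eq_max_neg] at *
    omega
  · rw [Zsqrtd.norm_eq_mul_conj]
    ring

end Octagon

/-- The octagon of Lenstra's and Graves' description of the sublevel sets of the minimal Euclidean
function. At level `n` the parameters are consecutive values of `halfPow`; passing from level `n`
to level `n + 1` replaces `(p, q)` by `(q, 2 * p)`. -/
def levelOctagon (p q : ℤ) : Set GaussianInt := octagon (p + q - 2) (2 * p + q - 3)

/-- A star-shaped (non-convex) part of `levelOctagon p q` whose even points are exactly the
multiples of `1 + i` by points of the star region one level below. -/
def starRegion (p q : ℤ) : Set GaussianInt :=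
  {z | |z.re| < |z.im| + q ∧ |z.im| < |z.re| + q ∧ (|z.re| < p ∨ |z.im| < p)}

section Regions

variable {p q : ℤ} {z : GaussianInt}

theorem mem_levelOctagon : z ∈ levelOctagon p q ↔
    |z.re| ≤ p + q - 2 ∧ |z.im| ≤ p + q - 2 ∧ |z.re| + |z.im| ≤ 2 * p + q - 3 := Iff.rfl

theorem mem_starRegion : z ∈ starRegion p q ↔
    |z.re| < |z.im| + q ∧ |z.im| < |z.re| + q ∧ (|z.re| < p ∨ |z.im| < p) := Iff.rfl

theorem levelOctagon_subset_levelOctagon (hp : 0 ≤ p) (hq : 0 ≤ q) :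
    levelOctagon p q ⊆ levelOctagon q (2 * p) :=
  octagon_subset_octagon (by lia) (by lia)

theorem onePlusI_mul_mem_levelOctagon (hz : z ∈ levelOctagon p q) :
    onePlusI * z ∈ levelOctagon q (2 * p) :=
  octagon_subset_octagon (by lia) (by lia) (onePlusI_mul_mem_octagon hz)

theorem starRegion_subset_levelOctagon : starRegion p q ⊆ levelOctagon p q := by
  intro z hz
  simp only [mem_starRegion, mem_levelOctagon] at *
  omega

theorem onePlusI_mul_mem_starRegion_iff :
    onePlusI * z ∈ starRegion q (2 * p) ↔ z ∈ starRegion p q := by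
  simp only [mem_starRegion, re_onePlusI_mul, im_onePlusI_mul, abs_eq_max_neg]
  omega

theorem abs_re_im_units_mul (u : GaussianIntˣ) (z : GaussianInt) :
    |(u * z).re| = |z.re| ∧ |(u * z).im| = |z.im| ∨
      |(u * z).re| = |z.im| ∧ |(u * z).im| = |z.re| := by
  have hnorm : (u : GaussianInt).norm = 1 :=
    (Zsqrtd.norm_eq_one_iff' (by norm_num) _).mpr u.isUnit
  rw [Zsqrtd.norm_def] at hnorm
  obtain ⟨hre₁, hre₂⟩ : -1 ≤ (u : GaussianInt).re ∧ (u : GaussianInt).re ≤ 1 :=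
    abs_le.mp <| abs_le_one_iff_mul_self_le_one.mpr <| by
      linarith [mul_self_nonneg (u : GaussianInt).im]
  obtain ⟨him₁, him₂⟩ : -1 ≤ (u : GaussianInt).im ∧ (u : GaussianInt).im ≤ 1 :=
    abs_le.mp <| abs_le_one_iff_mul_self_le_one.mpr <| by
      linarith [mul_self_nonneg (u : GaussianInt).re]
  rw [Zsqrtd.re_mul, Zsqrtd.im_mul]
  generalize (u : GaussianInt).re = c at *
  generalize (u : GaussianInt).im = d at *
  interval_cases c <;> interval_cases d <;> simp_all

theorem units_mul_mem_levelOctagon_iff (u : GaussianIntˣ) :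
    u * z ∈ levelOctagon p q ↔ z ∈ levelOctagon p q := by
  have habs := abs_re_im_units_mul u z
  simp only [mem_levelOctagon]
  lia

theorem units_mul_mem_starRegion_iff (u : GaussianIntˣ) :
    u * z ∈ starRegion p q ↔ z ∈ starRegion p q := by
  have habs := abs_re_im_units_mul u z
  simp only [mem_starRegion]
  lia

theorem star_mem_levelOctagon_iff : star z ∈ levelOctagon p q ↔ z ∈ levelOctagon p q := by
  simp only [mem_levelOctagon, Zsqrtd.re_star, Zsqrtd.im_star, abs_neg]

theorem star_mem_starRegion_iff : star z ∈ starRegion p q ↔ z ∈ starRegion p q := by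
  simp only [mem_starRegion, Zsqrtd.re_star, Zsqrtd.im_star, abs_neg]

theorem exists_units_mul_abs_im_le_re (z : GaussianInt) :
    ∃ u : GaussianIntˣ, |(u * z).im| ≤ (u * z).re := by
  let i : GaussianIntˣ := ⟨⟨0, 1⟩, ⟨0, -1⟩, by decide, by decide⟩
  have hi : (i : GaussianInt) = ⟨0, 1⟩ := rfl
  rcases le_total |z.re| |z.im| with h | h
  · rcases le_total 0 z.im with hsign | hsign
    · exact ⟨-i, by simpa [hi, abs_of_nonneg hsign] using h⟩
    · exact ⟨i, by simpa [hi, abs_of_nonpos hsign] using h⟩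
  · rcases le_total 0 z.re with hsign | hsign
    · exact ⟨1, by simpa [abs_of_nonneg hsign] using h⟩
    · exact ⟨-1, by simpa [abs_of_nonpos hsign] using h⟩

end Regions

/-- Reduction of `y` modulo `x` into the star region, or modulo `(1 + i) x` into the octagon. The
second alternative preserves the residue class modulo `1 + i`. -/
def ReducesInto (p q : ℤ) (x y : GaussianInt) : Prop :=
  (∃ r ∈ starRegion p q, x ∣ y - r) ∨ ∃ r ∈ levelOctagon p q, onePlusI * x ∣ y - r

namespace ReducesInto

variable {p q : ℤ} {x y : GaussianInt}

theorem of_sub_mul_mem_starRegion {t : GaussianInt} (h : y - t * x ∈ starRegion p q) :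
    ReducesInto p q x y :=
  Or.inl ⟨_, h, ⟨t, by ring⟩⟩

theorem of_sub_mul_mem_levelOctagon {t : GaussianInt} (ht : onePlusI ∣ t)
    (h : y - t * x ∈ levelOctagon p q) : ReducesInto p q x y :=
  Or.inr ⟨_, h, by simpa only [sub_sub_cancel] using mul_dvd_mul_right ht x⟩

theorem units_mul_left_iff (u : GaussianIntˣ) :
    ReducesInto p q (u * x) y ↔ ReducesInto p q x y := by
  simp only [ReducesInto, Units.mul_left_dvd, mul_left_comm onePlusI]

theorem of_units_mul_right (u : GaussianIntˣ) (h : ReducesInto p q x (u * y)) :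
    ReducesInto p q x y := by
  have hdvd {d r : GaussianInt} (hd : d ∣ u * y - r) : d ∣ y - ↑u⁻¹ * r := by
    simpa only [mul_sub, Units.inv_mul_cancel_left] using hd.mul_left (↑u⁻¹ : GaussianInt)
  rcases h with ⟨r, hr, hd⟩ | ⟨r, hr, hd⟩
  · exact Or.inl ⟨_, (units_mul_mem_starRegion_iff u⁻¹).mpr hr, hdvd hd⟩
  · exact Or.inr ⟨_, (units_mul_mem_levelOctagon_iff u⁻¹).mpr hr, hdvd hd⟩

theorem of_star (h : ReducesInto p q (star x) (star y)) : ReducesInto p q x y := by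
  have hdvd {d r : GaussianInt} (hd : d ∣ star y - r) : star d ∣ y - star r := by
    simpa only [starRingEnd_apply, map_sub, star_star] using map_dvd (starRingEnd GaussianInt) hd
  rcases h with ⟨r, hr, hd⟩ | ⟨r, hr, hd⟩
  · exact Or.inl ⟨_, star_mem_starRegion_iff.mpr hr, by simpa only [star_star] using hdvd hd⟩
  · refine Or.inr ⟨_, star_mem_levelOctagon_iff.mpr hr, dvd_trans ?_ (hdvd hd)⟩
    have hstar : onePlusI ∣ star onePlusI := onePlusI_dvd_iff.mpr (by decide)
    simpa only [star_mul, star_star, mul_comm x] using mul_dvd_mul_right hstar x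

end ReducesInto

section Reduction

variable {p q : ℤ} {x y z : GaussianInt}

theorem mem_levelOctagon_iff_linear : z ∈ levelOctagon p q ↔
    (-(p + q - 2) ≤ z.re ∧ z.re ≤ p + q - 2) ∧ (-(p + q - 2) ≤ z.im ∧ z.im ≤ p + q - 2) ∧
      z.re + z.im ≤ 2 * p + q - 3 ∧ z.re - z.im ≤ 2 * p + q - 3 ∧
      -z.re + z.im ≤ 2 * p + q - 3 ∧ -z.re - z.im ≤ 2 * p + q - 3 := by
  simp only [mem_levelOctagon, abs_eq_max_neg]
  omega

theorem bounds_of_mem_levelOctagon_sdiff (hz : z ∈ levelOctagon q (2 * p) \ levelOctagon p q)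
    (him : 0 ≤ z.im) (hle : z.im ≤ z.re) :
    z.re ≤ 2 * p + q - 2 ∧ z.re + z.im ≤ 2 * p + 2 * q - 3 ∧
      (p + q - 1 ≤ z.re ∨ 2 * p + q - 2 ≤ z.re + z.im) := by
  simp only [Set.mem_sdiff, mem_levelOctagon_iff_linear] at hz
  omega

/- When the arguments of `x` and `y` lie in the same sector of angle `π / 4`, the multiples of `x`
to subtract are `x` and `(1 ± i) x`, the sign being that of `y.im - x.im`. -/
theorem reducesInto_of_same_sector (hpq : p ≤ q) (hqp : q ≤ 2 * p) (hq : q = 1 ∨ Even q)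
    (hx : x ∈ levelOctagon q (2 * p) \ levelOctagon p q) (hx_im : 0 ≤ x.im) (hx_le : x.im ≤ x.re)
    (hy : y ∈ levelOctagon q (2 * p) \ levelOctagon p q) (hy_im : 0 ≤ y.im) (hy_le : y.im ≤ y.re)
    (hodd : ¬ onePlusI ∣ y) : ReducesInto p q x y := by
  obtain ⟨hx₁, hx₂, hx₃⟩ := bounds_of_mem_levelOctagon_sdiff hx hx_im hx_le
  obtain ⟨hy₁, hy₂, hy₃⟩ := bounds_of_mem_levelOctagon_sdiff hy hy_im hy_le
  rw [onePlusI_dvd_iff] at hodd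
  rw [Int.even_iff] at hodd hq
  by_cases hstar : y - 1 * x ∈ starRegion p q
  · exact .of_sub_mul_mem_starRegion hstar
  rw [one_mul, mem_starRegion, Zsqrtd.re_sub, Zsqrtd.im_sub] at hstar
  rcases le_total x.im y.im with him | him
  · refine .of_sub_mul_mem_levelOctagon (t := onePlusI) dvd_rfl ?_
    rw [mem_levelOctagon_iff_linear, Zsqrtd.re_sub, Zsqrtd.im_sub, re_onePlusI_mul,
      im_onePlusI_mul]
    rcases abs_cases (y.re - x.re) with hre | hre <;>
      rcases abs_cases (y.im - x.im) with him | him <;> omega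
  · refine .of_sub_mul_mem_levelOctagon (t := star onePlusI)
      (onePlusI_dvd_iff.mpr (by decide)) ?_
    have hre_mul : (star onePlusI * x).re = x.re + x.im := by simp [onePlusI]
    have him_mul : (star onePlusI * x).im = x.im - x.re := by simp [onePlusI, sub_eq_add_neg]
    rw [mem_levelOctagon_iff_linear, Zsqrtd.re_sub, Zsqrtd.im_sub, hre_mul, him_mul]
    rcases abs_cases (y.re - x.re) with hre | hre <;>
      rcases abs_cases (y.im - x.im) with him | him <;> omega

/- When the sectors are adjacent, the multiples of `star x` to subtract are those by `1`, `i` and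
`1 + i`. -/
theorem reducesInto_of_adjacent_sector (hpq : p ≤ q) (hqp : q ≤ 2 * p) (hq : q = 1 ∨ Even q)
    (hx : x ∈ levelOctagon q (2 * p) \ levelOctagon p q) (hx_im : 0 ≤ x.im) (hx_le : x.im ≤ x.re)
    (hy : y ∈ levelOctagon q (2 * p) \ levelOctagon p q) (hy_im : 0 ≤ y.im) (hy_le : y.im ≤ y.re)
    (hodd : ¬ onePlusI ∣ y) : ReducesInto p q (star x) y := by
  obtain ⟨hx₁, hx₂, hx₃⟩ := bounds_of_mem_levelOctagon_sdiff hx hx_im hx_le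
  obtain ⟨hy₁, hy₂, hy₃⟩ := bounds_of_mem_levelOctagon_sdiff hy hy_im hy_le
  rw [onePlusI_dvd_iff] at hodd
  rw [Int.even_iff] at hodd hq
  by_cases hstar : y - 1 * star x ∈ starRegion p q
  · exact .of_sub_mul_mem_starRegion hstar
  by_cases hstar' : y - Zsqrtd.sqrtd * star x ∈ starRegion p q
  · exact .of_sub_mul_mem_starRegion hstar'
  refine .of_sub_mul_mem_levelOctagon (t := onePlusI) dvd_rfl ?_
  simp only [mem_starRegion, one_mul, Zsqrtd.re_sub, Zsqrtd.im_sub, Zsqrtd.re_star,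
    Zsqrtd.im_star, Zsqrtd.re_mul, Zsqrtd.im_mul, Zsqrtd.re_sqrtd, Zsqrtd.im_sqrtd, zero_mul,
    zero_add, mul_one, neg_one_mul, neg_neg, sub_neg_eq_add] at hstar hstar'
  rw [mem_levelOctagon_iff_linear, Zsqrtd.re_sub, Zsqrtd.im_sub, re_onePlusI_mul,
    im_onePlusI_mul, Zsqrtd.re_star, Zsqrtd.im_star]
  rcases abs_cases (y.re - x.re) with h₁ | h₁ <;> rcases abs_cases (y.im + x.im) with h₂ | h₂ <;>
    rcases abs_cases (y.re - x.im) with h₃ | h₃ <;>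
    rcases abs_cases (y.im - x.re) with h₄ | h₄ <;> omega

theorem reducesInto_of_mem_sector (hpq : p ≤ q) (hqp : q ≤ 2 * p) (hq : q = 1 ∨ Even q)
    (hx : x ∈ levelOctagon q (2 * p) \ levelOctagon p q)
    (hy : y ∈ levelOctagon q (2 * p) \ levelOctagon p q) (hy_im : 0 ≤ y.im) (hy_le : y.im ≤ y.re)
    (hodd : ¬ onePlusI ∣ y) : ReducesInto p q x y := by
  obtain ⟨u, hu⟩ := exists_units_mul_abs_im_le_re x
  rw [← ReducesInto.units_mul_left_iff u]
  have hux : u * x ∈ levelOctagon q (2 * p) \ levelOctagon p q := by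
    simpa only [Set.mem_sdiff, units_mul_mem_levelOctagon_iff] using hx
  rcases le_total 0 (u * x).im with hsign | hsign
  · rw [abs_of_nonneg hsign] at hu
    exact reducesInto_of_same_sector hpq hqp hq hux hsign hu hy hy_im hy_le hodd
  · rw [abs_of_nonpos hsign] at hu
    have hstar : star (u * x) ∈ levelOctagon q (2 * p) \ levelOctagon p q := by
      simpa only [Set.mem_sdiff, star_mem_levelOctagon_iff] using hux
    rw [← star_star (u * x)]
    exact reducesInto_of_adjacent_sector hpq hqp hq hstar (neg_nonneg.mpr hsign) hu hy hy_im
      hy_le hodd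

theorem reducesInto_of_mem_levelOctagon_sdiff (hpq : p ≤ q) (hqp : q ≤ 2 * p) (hq : q = 1 ∨ Even q)
    (hx : x ∈ levelOctagon q (2 * p) \ levelOctagon p q)
    (hy : y ∈ levelOctagon q (2 * p) \ levelOctagon p q) (hodd : ¬ onePlusI ∣ y) :
    ReducesInto p q x y := by
  obtain ⟨u, hu⟩ := exists_units_mul_abs_im_le_re y
  have huy : u * y ∈ levelOctagon q (2 * p) \ levelOctagon p q := by
    simpa only [Set.mem_sdiff, units_mul_mem_levelOctagon_iff] using hy
  have hodd_uy : ¬ onePlusI ∣ u * y := by rwa [Units.dvd_mul_left]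
  refine .of_units_mul_right u ?_
  rcases le_total 0 (u * y).im with hsign | hsign
  · rw [abs_of_nonneg hsign] at hu
    exact reducesInto_of_mem_sector hpq hqp hq hx huy hsign hu hodd_uy
  · rw [abs_of_nonpos hsign] at hu
    refine .of_star (reducesInto_of_mem_sector hpq hqp hq ?_ ?_ (neg_nonneg.mpr hsign) hu ?_)
    · simpa only [Set.mem_sdiff, star_mem_levelOctagon_iff] using hx
    · simpa only [Set.mem_sdiff, star_mem_levelOctagon_iff] using huy
    · rwa [onePlusI_dvd_star_iff]

end Reduction

/-- The powers of two `2 ^ ⌊n / 2⌋`. Lenstra's and Graves' widths are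
`w n = halfPow n + halfPow (n + 1)`, up to a shift of the index. -/
def halfPow (n : ℕ) : ℤ := 2 ^ (n / 2)

theorem halfPow_add_two (n : ℕ) : halfPow (n + 2) = 2 * halfPow n := by
  rw [halfPow, halfPow, Nat.add_div_right n two_pos, pow_succ']

theorem halfPow_pos (n : ℕ) : 0 < halfPow n := pow_pos two_pos _

theorem halfPow_le_halfPow_succ (n : ℕ) : halfPow n ≤ halfPow (n + 1) :=
  pow_le_pow_right₀ one_le_two (Nat.div_le_div_right n.le_succ)

theorem halfPow_succ_le_two_mul (n : ℕ) : halfPow (n + 1) ≤ 2 * halfPow n :=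
  (halfPow_le_halfPow_succ (n + 1)).trans_eq (halfPow_add_two n)

theorem halfPow_eq_one_or_even (n : ℕ) : halfPow n = 1 ∨ Even (halfPow n) := by
  rcases eq_or_ne (n / 2) 0 with h | h
  · exact Or.inl (by rw [halfPow, h, pow_zero])
  · exact Or.inr ((even_two).pow_of_ne_zero h)

theorem onePlusI_pow_mem_octagon (n : ℕ) :
    onePlusI ^ n ∈ octagon (halfPow n) (halfPow (n + 1)) := by
  induction n with
  | zero => simp [mem_octagon, halfPow]
  | succ n ih =>
    rw [pow_succ', halfPow_add_two]
    exact onePlusI_mul_mem_octagon ih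

/-- The set `{φ < n}` for the minimal Euclidean function `φ` of `ℤ[i]`, described by the
`(1 + i)`-adic valuation: it consists of `0` and the products `(1 + i) ^ j * x` with `x` odd in the
octagon of level `n - j`. -/
def lenstraSet : ℕ → Set GaussianInt
  | 0 => {0}
  | n + 1 => {x | ¬ onePlusI ∣ x ∧ x ∈ levelOctagon (halfPow (n + 1)) (halfPow (n + 2))} ∪
      (onePlusI * ·) '' lenstraSet n

section LenstraSet

variable {n : ℕ} {x y z : GaussianInt}

theorem onePlusI_mul_mem_lenstraSet_succ_iff :
    onePlusI * x ∈ lenstraSet (n + 1) ↔ x ∈ lenstraSet n := by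
  simp [lenstraSet, prime_onePlusI.ne_zero]

theorem mem_lenstraSet_succ_iff_of_not_dvd (hx : ¬ onePlusI ∣ x) :
    x ∈ lenstraSet (n + 1) ↔ x ∈ levelOctagon (halfPow (n + 1)) (halfPow (n + 2)) := by
  refine ⟨?_, fun h => Or.inl ⟨hx, h⟩⟩
  rintro (⟨-, h⟩ | ⟨w, -, rfl⟩)
  · exact h
  · exact absurd (dvd_mul_right _ _) hx

theorem zero_mem_lenstraSet (n : ℕ) : 0 ∈ lenstraSet n := by
  induction n with
  | zero => rfl
  | succ n ih => rwa [← mul_zero onePlusI, onePlusI_mul_mem_lenstraSet_succ_iff]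

theorem lenstraSet_subset_levelOctagon (n : ℕ) :
    lenstraSet n ⊆ levelOctagon (halfPow n) (halfPow (n + 1)) := by
  induction n with
  | zero =>
    rintro x rfl
    simp [mem_levelOctagon, halfPow]
  | succ n ih =>
    rintro x (⟨-, hx⟩ | ⟨w, hw, rfl⟩)
    · exact hx
    · rw [halfPow_add_two]
      exact onePlusI_mul_mem_levelOctagon (ih hw)

theorem eq_zero_of_mem_levelOctagon_zero (hx : x ∈ levelOctagon (halfPow 0) (halfPow 1)) :
    x = 0 := by
  obtain ⟨hre, him, -⟩ := hx
  exact Zsqrtd.ext (abs_nonpos_iff.mp hre) (abs_nonpos_iff.mp him)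

theorem mem_lenstraSet_of_mem_levelOctagon (hx : ¬ onePlusI ∣ x)
    (h : x ∈ levelOctagon (halfPow n) (halfPow (n + 1))) : x ∈ lenstraSet n := by
  cases n with
  | zero => exact eq_zero_of_mem_levelOctagon_zero h
  | succ n => exact Or.inl ⟨hx, h⟩

theorem levelOctagon_halfPow_subset_succ (n : ℕ) :
    levelOctagon (halfPow n) (halfPow (n + 1)) ⊆
      levelOctagon (halfPow (n + 1)) (halfPow (n + 2)) := by
  rw [halfPow_add_two]
  exact levelOctagon_subset_levelOctagon (halfPow_pos n).le (halfPow_pos (n + 1)).le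

theorem lenstraSet_subset_succ (n : ℕ) : lenstraSet n ⊆ lenstraSet (n + 1) := by
  induction n with
  | zero =>
    rintro x rfl
    exact zero_mem_lenstraSet 1
  | succ n ih =>
    rintro x (⟨hodd, hx⟩ | ⟨w, hw, rfl⟩)
    · exact Or.inl ⟨hodd, levelOctagon_halfPow_subset_succ (n + 1) hx⟩
    · exact Or.inr ⟨w, ih hw, rfl⟩

theorem starRegion_subset_lenstraSet (n : ℕ) :
    starRegion (halfPow n) (halfPow (n + 1)) ⊆ lenstraSet n := by
  induction n with
  | zero => exact fun x hx => eq_zero_of_mem_levelOctagon_zero (starRegion_subset_levelOctagon hx)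
  | succ n ih =>
    intro x hx
    by_cases hdvd : onePlusI ∣ x
    · obtain ⟨w, rfl⟩ := hdvd
      rw [halfPow_add_two, onePlusI_mul_mem_starRegion_iff] at hx
      exact onePlusI_mul_mem_lenstraSet_succ_iff.mpr (ih hx)
    · exact Or.inl ⟨hdvd, starRegion_subset_levelOctagon hx⟩

theorem mem_lenstraSet_of_mul_mem_lenstraSet (hne : x * z ≠ 0) (h : x * z ∈ lenstraSet n) :
    x ∈ lenstraSet n := by
  induction n generalizing x z with
  | zero => exact absurd h hne
  | succ n ih =>
    by_cases hdvd : onePlusI ∣ x * z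
    · rcases prime_onePlusI.dvd_or_dvd hdvd with ⟨w, rfl⟩ | ⟨w, rfl⟩
      · rw [mul_assoc] at hne h
        rw [onePlusI_mul_mem_lenstraSet_succ_iff] at h ⊢
        exact ih (right_ne_zero_of_mul hne) h
      · rw [mul_left_comm] at hne h
        rw [onePlusI_mul_mem_lenstraSet_succ_iff] at h
        exact lenstraSet_subset_succ n (ih (right_ne_zero_of_mul hne) h)
    · have hx : ¬ onePlusI ∣ x := fun hx => hdvd (hx.mul_right z)
      rw [mem_lenstraSet_succ_iff_of_not_dvd hdvd] at h
      rw [mem_lenstraSet_succ_iff_of_not_dvd hx]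
      exact mem_octagon_of_mul_mem_octagon (right_ne_zero_of_mul hne) h

theorem onePlusI_pow_sub_mem_lenstraSet {r : GaussianInt} (hr : r ∈ lenstraSet n) :
    onePlusI ^ n - r ≠ 0 ∧ onePlusI ^ n - r ∈ lenstraSet (n + 1) := by
  induction n generalizing r with
  | zero =>
    obtain rfl : r = 0 := hr
    have hone : ¬ onePlusI ∣ 1 := prime_onePlusI.not_dvd_one
    rw [pow_zero, sub_zero, mem_lenstraSet_succ_iff_of_not_dvd hone]
    exact ⟨one_ne_zero, by simp [mem_levelOctagon, halfPow]⟩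
  | succ n ih =>
    rcases hr with ⟨hodd, hr⟩ | ⟨w, hw, rfl⟩
    · have hodd_sub : ¬ onePlusI ∣ onePlusI ^ (n + 1) - r := by
        rwa [dvd_sub_right (dvd_pow_self _ n.succ_ne_zero)]
      refine ⟨fun h => hodd_sub (h ▸ dvd_zero _), Or.inl ⟨hodd_sub, ?_⟩⟩
      rw [halfPow_add_two (n + 1)]
      exact octagon_subset_octagon (by lia) (by lia)
        (sub_mem_octagon (onePlusI_pow_mem_octagon (n + 1)) hr)
    · rw [pow_succ', ← mul_sub, onePlusI_mul_mem_lenstraSet_succ_iff]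
      exact ⟨mul_ne_zero prime_onePlusI.ne_zero (ih hw).1, (ih hw).2⟩

theorem mem_lenstraSet_succ_of_forall_exists_dvd_sub
    (h : ∀ a, ∃ r ∈ lenstraSet n, x ∣ a - r) : x ∈ lenstraSet (n + 1) := by
  obtain ⟨r, hr, z, hz⟩ := h (onePlusI ^ n)
  obtain ⟨hne, hmem⟩ := onePlusI_pow_sub_mem_lenstraSet hr
  rw [hz] at hne hmem
  exact mem_lenstraSet_of_mul_mem_lenstraSet hne hmem

theorem exists_not_dvd_and_dvd_sub (hx : ¬ onePlusI ∣ x) (a : GaussianInt) :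
    ∃ b, ¬ onePlusI ∣ b ∧ x ∣ a - b := by
  by_cases ha : onePlusI ∣ a
  · exact ⟨a + x, by rwa [dvd_add_right ha], by simp⟩
  · exact ⟨a, ha, by simp⟩

theorem not_dvd_of_onePlusI_mul_dvd_sub (hy : ¬ onePlusI ∣ y) (h : onePlusI * x ∣ y - z) :
    ¬ onePlusI ∣ z := fun hz =>
  hy ((dvd_sub_left hz).mp ((dvd_mul_right _ _).trans h))

theorem exists_mem_lenstraSet_dvd_sub_of_odd (hx : ¬ onePlusI ∣ x)
    (hxmem : x ∈ levelOctagon (halfPow (n + 1)) (halfPow (n + 2)) \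
      levelOctagon (halfPow n) (halfPow (n + 1))) (a : GaussianInt) :
    ∃ r ∈ lenstraSet n, x ∣ a - r := by
  obtain ⟨y, hy, hay⟩ := exists_not_dvd_and_dvd_sub hx a
  have hx0 : x ≠ 0 := fun h => hx (h ▸ dvd_zero _)
  obtain ⟨z, hz, hyz⟩ := exists_mem_octagon_onePlusI_mul_dvd_sub hx0 hxmem.1 y
  have haz : x ∣ a - z := by
    simpa only [sub_add_sub_cancel] using dvd_add hay ((dvd_mul_left _ _).trans hyz)
  have hz_odd := not_dvd_of_onePlusI_mul_dvd_sub hy hyz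
  by_cases hz' : z ∈ levelOctagon (halfPow n) (halfPow (n + 1))
  · exact ⟨z, mem_lenstraSet_of_mem_levelOctagon hz_odd hz', haz⟩
  have hred : ReducesInto (halfPow n) (halfPow (n + 1)) x z := by
    rw [halfPow_add_two] at hxmem
    refine reducesInto_of_mem_levelOctagon_sdiff (halfPow_le_halfPow_succ n)
      (halfPow_succ_le_two_mul n) (halfPow_eq_one_or_even (n + 1)) hxmem ⟨?_, hz'⟩ hz_odd
    rwa [← halfPow_add_two]
  have htrans {r : GaussianInt} (h : x ∣ z - r) : x ∣ a - r := by
    simpa only [sub_add_sub_cancel] using dvd_add haz h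
  rcases hred with ⟨r, hr, hd⟩ | ⟨r, hr, hd⟩
  · exact ⟨r, starRegion_subset_lenstraSet n hr, htrans hd⟩
  · have hr_odd := not_dvd_of_onePlusI_mul_dvd_sub hz_odd hd
    exact ⟨r, mem_lenstraSet_of_mem_levelOctagon hr_odd hr, htrans ((dvd_mul_left _ _).trans hd)⟩

theorem exists_mem_lenstraSet_succ_onePlusI_mul_dvd_sub (hx0 : x ≠ 0)
    (hx : x ∈ lenstraSet (n + 1)) (h : ∀ a, ∃ r ∈ lenstraSet n, x ∣ a - r) (a : GaussianInt) :
    ∃ r ∈ lenstraSet (n + 1), onePlusI * x ∣ a - r := by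
  by_cases ha : onePlusI ∣ a
  · obtain ⟨b, rfl⟩ := ha
    obtain ⟨r, hr, hd⟩ := h b
    refine ⟨onePlusI * r, onePlusI_mul_mem_lenstraSet_succ_iff.mpr hr, ?_⟩
    rw [← mul_sub]
    exact mul_dvd_mul_left onePlusI hd
  · obtain ⟨r, hr, hd⟩ :=
      exists_mem_octagon_onePlusI_mul_dvd_sub hx0 (lenstraSet_subset_levelOctagon (n + 1) hx) a
    have hr_odd := not_dvd_of_onePlusI_mul_dvd_sub ha hd
    exact ⟨r, mem_lenstraSet_of_mem_levelOctagon hr_odd hr, hd⟩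

theorem exists_mem_lenstraSet_dvd_sub (hx0 : x ≠ 0) (hx : x ∈ lenstraSet (n + 1))
    (a : GaussianInt) : ∃ r ∈ lenstraSet n, x ∣ a - r := by
  induction n generalizing x a with
  | zero =>
    rcases hx with ⟨hodd, hx⟩ | ⟨w, rfl, rfl⟩
    · exact exists_mem_lenstraSet_dvd_sub_of_odd hodd
        ⟨hx, fun h => hx0 (eq_zero_of_mem_levelOctagon_zero h)⟩ a
    · exact absurd (mul_zero _) hx0
  | succ n ih =>
    rcases hx with ⟨hodd, hx⟩ | ⟨w, hw, rfl⟩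
    · by_cases hx' : x ∈ levelOctagon (halfPow (n + 1)) (halfPow (n + 2))
      · obtain ⟨r, hr, hd⟩ := ih hx0 (mem_lenstraSet_of_mem_levelOctagon hodd hx') a
        exact ⟨r, lenstraSet_subset_succ n hr, hd⟩
      · exact exists_mem_lenstraSet_dvd_sub_of_odd hodd ⟨hx, hx'⟩ a
    · have hw0 := right_ne_zero_of_mul hx0
      exact exists_mem_lenstraSet_succ_onePlusI_mul_dvd_sub hw0 hw (ih hw0 hw) a

theorem motzkinSet_gaussianInt (n : ℕ) : motzkinSet GaussianInt n = lenstraSet n := by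
  induction n with
  | zero => rfl
  | succ n ih =>
    ext x
    simp only [motzkinSet, ih, Set.mem_ofPred_eq]
    refine ⟨?_, fun hx => or_iff_not_imp_left.mpr fun hx0 => exists_mem_lenstraSet_dvd_sub hx0 hx⟩
    rintro (rfl | h)
    · exact zero_mem_lenstraSet (n + 1)
    · exact mem_lenstraSet_succ_of_forall_exists_dvd_sub h

theorem minimalEuclideanFunction_gaussianInt_le_iff :
    minimalEuclideanFunction GaussianInt x ≤ n ↔ x ∈ lenstraSet (n + 1) := by
  rw [minimalEuclideanFunction_le_iff_mem_motzkinSet isEuclideanFunction_norm_gaussianInt,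
    motzkinSet_gaussianInt]

end LenstraSet

section Counting

theorem sum_Ico_neg_comp_max {M : Type*} [AddCommMonoid M] (f : ℤ → M) (n : ℕ) :
    ∑ a ∈ Finset.Ico (-n : ℤ) n, f (max a (-1 - a)) = 2 • ∑ i ∈ Finset.range n, f i := by
  induction n with
  | zero => simp
  | succ n ih =>
    have hIco : Finset.Ico (-(n + 1 : ℕ) : ℤ) (n + 1 : ℕ) =
        insert (-(n + 1) : ℤ) (insert (n : ℤ) (Finset.Ico (-n : ℤ) n)) := by
      ext a
      simp only [Finset.mem_Ico, Finset.mem_insert]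
      lia
    have hleft : max (-(n + 1) : ℤ) (-1 - -(n + 1)) = n := by lia
    have hright : max (n : ℤ) (-1 - n) = n := by lia
    rw [hIco, Finset.sum_insert (by simp), Finset.sum_insert (by simp), ih, hleft, hright,
      Finset.sum_range_succ]
    abel

theorem two_mul_sum_range_sub {R : Type*} [CommRing R] (c : R) (n : ℕ) :
    2 * ∑ i ∈ Finset.range n, (c - i) = 2 * n * c - n * (n - 1) := by
  induction n with
  | zero => simp
  | succ n ih =>
    rw [Finset.sum_range_succ, mul_add, ih]
    push_cast
    ring

theorem two_mul_sum_range_min (d e : ℕ) :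
    2 * ∑ i ∈ Finset.range (d + e), min (d + e : ℤ) (2 * d + e - 1 - i) =
      2 * (d + e) ^ 2 - e * (e + 1) := by
  have hleft : ∑ i ∈ Finset.range d, min (d + e : ℤ) (2 * d + e - 1 - i) = d * (d + e) := by
    rw [Finset.sum_congr rfl fun i hi => min_eq_left (by rw [Finset.mem_range] at hi; lia)]
    simp
  have hright : 2 * ∑ j ∈ Finset.range e, min (d + e : ℤ) (2 * d + e - 1 - (d + j : ℕ)) =
      2 * e * (d + e) - e * (e + 1) := by
    rw [Finset.sum_congr rfl fun j _ => min_eq_right (by lia)]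
    push_cast
    simp only [← sub_sub]
    rw [two_mul_sum_range_sub]
    ring
  rw [Finset.sum_range_add, mul_add, hleft, hright]
  ring

/-- A parametrization of the odd Gaussian integers by their coordinates with respect to the
origin `1` and the directions `1 + i` and `1 - i`. -/
def oddPoint (c : Σ _ : ℤ, ℤ) : GaussianInt := ⟨c.1 + c.2 + 1, c.1 - c.2⟩

theorem oddPoint_injective : Function.Injective oddPoint := by
  rintro ⟨a, b⟩ ⟨a', b'⟩ h
  have hre := congrArg Zsqrtd.re h
  have him := congrArg Zsqrtd.im h
  simp only [oddPoint] at hre him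
  obtain rfl : a = a' := by lia
  obtain rfl : b = b' := by lia
  rfl

theorem not_onePlusI_dvd_iff_exists_oddPoint {z : GaussianInt} :
    ¬ onePlusI ∣ z ↔ ∃ c, oddPoint c = z := by
  rw [onePlusI_dvd_iff, Int.not_even_iff_odd]
  constructor
  · rintro ⟨k, hk⟩
    exact ⟨⟨k, z.re - k - 1⟩, by ext <;> simp only [oddPoint] <;> lia⟩
  · rintro ⟨c, rfl⟩
    exact ⟨c.1, by simp only [oddPoint]; ring⟩

/-- The coordinates of the odd points of `octagon (2 * d + e - 1) (2 * d + 2 * e - 1)`. -/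
noncomputable def oddOctagonCoords (d e : ℕ) : Finset (Σ _ : ℤ, ℤ) :=
  (Finset.Ico (-(d + e : ℕ) : ℤ) (d + e : ℕ)).sigma fun a =>
    Finset.Ico (-min (d + e : ℤ) (2 * d + e - 1 - max a (-1 - a)))
      (min (d + e : ℤ) (2 * d + e - 1 - max a (-1 - a)))

theorem oddPoint_mem_octagon_iff {d e : ℕ} {c : Σ _ : ℤ, ℤ} :
    oddPoint c ∈ octagon (2 * d + e - 1) (2 * d + 2 * e - 1) ↔ c ∈ oddOctagonCoords d e := by
  simp only [oddOctagonCoords, oddPoint, mem_octagon, Finset.mem_sigma, Finset.mem_Ico,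
    abs_eq_max_neg]
  omega

theorem card_oddOctagonCoords (d e : ℕ) :
    ((oddOctagonCoords d e).card : ℤ) = 4 * (d + e) ^ 2 - 2 * e * (e + 1) := by
  let width (i : ℤ) : ℤ := 2 * min (d + e : ℤ) (2 * d + e - 1 - i)
  calc
    ((oddOctagonCoords d e).card : ℤ)
      = ∑ a ∈ Finset.Ico (-(d + e : ℕ) : ℤ) (d + e : ℕ), width (max a (-1 - a)) := by
        rw [oddOctagonCoords, Finset.card_sigma, Nat.cast_sum]
        refine Finset.sum_congr rfl fun a ha => ?_
        rw [Finset.mem_Ico] at ha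
        rw [Int.card_Ico]
        lia
    _ = 2 * (2 * ∑ i ∈ Finset.range (d + e), min (d + e : ℤ) (2 * d + e - 1 - i)) := by
        rw [sum_Ico_neg_comp_max width, ← Finset.mul_sum, nsmul_eq_mul, Nat.cast_ofNat]
    _ = 4 * (d + e) ^ 2 - 2 * e * (e + 1) := by
        rw [two_mul_sum_range_min]
        ring

theorem setOf_odd_mem_octagon (d e : ℕ) :
    {x | ¬ onePlusI ∣ x ∧ x ∈ octagon (2 * d + e - 1) (2 * d + 2 * e - 1)} =
      oddPoint '' oddOctagonCoords d e := by
  ext x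
  simp only [Set.mem_ofPred_eq, not_onePlusI_dvd_iff_exists_oddPoint, Set.mem_image,
    Finset.mem_coe, ← oddPoint_mem_octagon_iff]
  constructor
  · rintro ⟨⟨c, rfl⟩, hc⟩
    exact ⟨c, hc, rfl⟩
  · rintro ⟨c, hc, rfl⟩
    exact ⟨⟨c, rfl⟩, hc⟩

theorem finite_setOf_odd_mem_octagon (d e : ℕ) :
    {x | ¬ onePlusI ∣ x ∧ x ∈ octagon (2 * d + e - 1) (2 * d + 2 * e - 1)}.Finite := by
  rw [setOf_odd_mem_octagon]
  exact (oddOctagonCoords d e).finite_toSet.image oddPoint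

theorem ncard_setOf_odd_mem_octagon (d e : ℕ) :
    ({x | ¬ onePlusI ∣ x ∧ x ∈ octagon (2 * d + e - 1) (2 * d + 2 * e - 1)}.ncard : ℤ) =
      4 * (d + e) ^ 2 - 2 * e * (e + 1) := by
  rw [setOf_odd_mem_octagon, Set.ncard_image_of_injective _ oddPoint_injective,
    Set.ncard_coe_finset, card_oddOctagonCoords]

theorem levelOctagon_two_mul_eq_octagon {p q : ℤ} (hp : 0 ≤ p) (hq : 0 < q) :
    levelOctagon q (2 * p) =
      octagon (2 * p.toNat + (q - 1).toNat - 1) (2 * p.toNat + 2 * (q - 1).toNat - 1) := by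
  rw [levelOctagon]
  congr 1 <;> lia

theorem finite_setOf_odd_mem_levelOctagon {p q : ℤ} (hp : 0 ≤ p) (hq : 0 < q) :
    {x | ¬ onePlusI ∣ x ∧ x ∈ levelOctagon q (2 * p)}.Finite := by
  rw [levelOctagon_two_mul_eq_octagon hp hq]
  exact finite_setOf_odd_mem_octagon _ _

theorem ncard_setOf_odd_mem_levelOctagon {p q : ℤ} (hp : 0 ≤ p) (hq : 0 < q) :
    ({x | ¬ onePlusI ∣ x ∧ x ∈ levelOctagon q (2 * p)}.ncard : ℤ) =
      4 * (p + q - 1) ^ 2 - 2 * q * (q - 1) := by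
  rw [levelOctagon_two_mul_eq_octagon hp hq, ncard_setOf_odd_mem_octagon, Int.toNat_of_nonneg hp,
    Int.toNat_of_nonneg (by lia)]
  ring

theorem finite_lenstraSet (n : ℕ) : (lenstraSet n).Finite := by
  induction n with
  | zero => exact Set.finite_singleton 0
  | succ n ih =>
    rw [lenstraSet, halfPow_add_two]
    exact (finite_setOf_odd_mem_levelOctagon (halfPow_pos n).le (halfPow_pos (n + 1))).union
      (ih.image _)

theorem ncard_lenstraSet_succ (n : ℕ) :
    ((lenstraSet (n + 1)).ncard : ℤ) = (lenstraSet n).ncard +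
      4 * (halfPow n + halfPow (n + 1) - 1) ^ 2 - 2 * halfPow (n + 1) * (halfPow (n + 1) - 1) := by
  have hp := (halfPow_pos n).le
  have hq := halfPow_pos (n + 1)
  have hdisj : Disjoint
      {x | ¬ onePlusI ∣ x ∧ x ∈ levelOctagon (halfPow (n + 1)) (2 * halfPow n)}
      ((onePlusI * ·) '' lenstraSet n) := by
    rw [Set.disjoint_left]
    rintro _ ⟨hodd, -⟩ ⟨w, -, rfl⟩
    exact hodd (dvd_mul_right _ _)
  rw [lenstraSet, halfPow_add_two, Set.ncard_union_eq hdisj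
    (finite_setOf_odd_mem_levelOctagon hp hq) ((finite_lenstraSet n).image _),
    Set.ncard_image_of_injective _ (mul_right_injective₀ prime_onePlusI.ne_zero), Nat.cast_add,
    ncard_setOf_odd_mem_levelOctagon hp hq]
  ring

theorem halfPow_two_mul (k : ℕ) : halfPow (2 * k) = 2 ^ k := by
  rw [halfPow, Nat.mul_div_cancel_left k two_pos]

theorem halfPow_two_mul_add_one (k : ℕ) : halfPow (2 * k + 1) = 2 ^ k := by
  rw [halfPow, Nat.mul_add_div two_pos, Nat.div_eq_of_lt one_lt_two, add_zero]

theorem ncard_lenstraSet_two_mul_add_one (k : ℕ) :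
    ((lenstraSet (2 * k + 1)).ncard : ℤ) = 25 + 8 * k - 48 * 2 ^ k + 28 * 4 ^ k := by
  induction k with
  | zero =>
    have hzero : (lenstraSet 0).ncard = 1 := Set.ncard_singleton 0
    rw [ncard_lenstraSet_succ, mul_zero, hzero]
    simp [halfPow]
  | succ k ih =>
    have hfour : (4 : ℤ) ^ k = (2 ^ k) ^ 2 := by rw [pow_right_comm]; norm_num
    have hone : halfPow (2 * k + 1) = 2 ^ k := halfPow_two_mul_add_one k
    have htwo : halfPow (2 * k + 1 + 1) = 2 * 2 ^ k := by
      rw [halfPow_add_two, halfPow_two_mul]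
    have hthree : halfPow (2 * k + 1 + 1 + 1) = 2 * 2 ^ k := by
      rw [halfPow_add_two, hone]
    rw [mul_add_one, ncard_lenstraSet_succ, ncard_lenstraSet_succ, ih, hone, htwo, hthree,
      pow_succ 4, pow_succ 2, hfour]
    push_cast
    ring

end Counting

theorem mainTheorem1 (k : ℕ) (hk : 1 ≤ k) :
    (minimalEuclideanFunction GaussianInt ⁻¹' Set.Icc 0 (2 * k)).Finite ∧
      ((minimalEuclideanFunction GaussianInt ⁻¹' Set.Icc 0 (2 * k)).ncard : ℤ) =
        25 + 8 * (k : ℤ) - 48 * 2 ^ k + 28 * 4 ^ k := by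
  have hpreimage : minimalEuclideanFunction GaussianInt ⁻¹' Set.Icc 0 (2 * k) =
      lenstraSet (2 * k + 1) := by
    ext x
    rw [Set.mem_preimage, Set.mem_Icc, and_iff_right (Nat.zero_le _),
      minimalEuclideanFunction_gaussianInt_le_iff]
  rw [hpreimage]
  exact ⟨finite_lenstraSet _, ncard_lenstraSet_two_mul_add_one k⟩
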